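/- Let $k,s$ be positive integers. For each positive integer $n$, let $P_{n,k,s}$ be the Minkowski sum of the $n$ simplices $\Delta_{\{si,si+1,\ldots,si+k-1\}}=\operatorname{conv}\{e_{si},e_{si+1},\ldots,e_{si+k-1}\}$, $i=0,\ldots,n-1$, in $\mathbb{R}^{s(n-1)+k}$ with canonical basis $e_0,\ldots,e_{s(n-1)+k-1}$, and let $b_n^{(k,s)}$ be the number of vertices of $P_{n,k,s}$. Let $D_{k,s}$ be the directed graph with vertices $0,1,\ldots,k-1$ and an arc $(i,j)$ for every ordered pair of vertices (loops included), except for the pairs $(s+a,b)$ with $a,b\in\{0,\ldots,k-1-s\}$ and $a\neq b$ (no pair is excepted if $k\le s$). Let $A_{k,s}$ be the $k\times k$ adjacency matrix of $D_{k,s}$. Then: 1. the matrix $A_{k,s}$ is irreducible, i.e. it is entrywise nonnegative and $D_{k,s}$ is strongly connected; 2. $A_{k,s}$ has a largest positive real eigenvalue $\lambda_1$, and $$\lim_{n\to\infty}\frac1n\ln b_n^{(k,s)}=\ln\lambda_1 .$$ -/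

import Mathlib

open Filter Topology
open scoped Pointwise

noncomputable section

namespace MaxPool

/-- The `i`-th pooling window `{si, si+1, …, si+k-1}`, as a subset of the index set
`{0, …, N-1}`. -/
def window (N k s i : ℕ) : Set (Fin N) :=
  {x | s * i ≤ (x : ℕ) ∧ (x : ℕ) < s * i + k}

/-- The simplex `Δ_S = conv {e_x : x ∈ S}` in `ℝ^N`, where `e_x` is the canonical basis. -/
def simplex {N : ℕ} (S : Set (Fin N)) : Set (Fin N → ℝ) :=
  convexHull ℝ ((fun x : Fin N => (Pi.single x (1 : ℝ) : Fin N → ℝ)) '' S)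

/-- The polytope `P_{n,k,s}`: the Minkowski sum of the simplices on the first `n` windows
of size `k` and stride `s`. The ambient index set
`{0, …, s(n-1)+k-1}` contains all these windows when `n ≥ 1`. -/
def polytope (n k s : ℕ) : Set (Fin (s * (n - 1) + k) → ℝ) :=
  ∑ i ∈ Finset.range n, simplex (window (s * (n - 1) + k) k s i)

/-- `b_n^{(k,s)}`: the number of vertices (extreme points) of `P_{n,k,s}`. -/
def numVertices (n k s : ℕ) : ℕ :=
  ((polytope n k s).extremePoints ℝ).ncard

/-- The digraph `D_{k,s}` on `{0, …, k-1}`: all arcs (including loops) are present except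
the arcs `(s + a, b)` with `a, b ∈ {0, …, k-1-s}` and `a ≠ b` (none is missing if `k ≤ s`). -/
def digraph (k s : ℕ) : Digraph (Fin k) where
  Adj i j := ¬ ∃ a b : ℕ, s + a < k ∧ s + b < k ∧ a ≠ b ∧ (i : ℕ) = s + a ∧ (j : ℕ) = b

open Classical in
/-- The adjacency matrix `A_{k,s}` of `D_{k,s}`. -/
def adjMatrix (k s : ℕ) : Matrix (Fin k) (Fin k) ℝ :=
  Matrix.of fun i j => if (digraph k s).Adj i j then 1 else 0

end MaxPool

end

/-! A vertex of a Minkowski sum of simplices selects one basis index in each window. If the choices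
of two windows both lie in both windows they must agree, since otherwise swapping them exhibits the
point as a midpoint. For consecutive windows, in offsets, this forbids exactly the missing arcs of
D. Conversely, agreement on consecutive windows already yields a weight whose strict maximum in
every window is the chosen index (`exists_weight_of_consistent`); it exposes the vertex and
determines the choices. So vertices of P_n biject with walks on n vertices (`numVertices_succ`). By
Perron–Frobenius A has an eigenvector v > 0 with eigenvalue λ > 0. Squeezing the all-ones vector
between multiples of v bounds the walk count by constants times λ^(n-1) on both sides. -/

namespace MaxPool

/-! ### Perron–Frobenius via Collatz–Wielandt -/

section PerronFrobenius

open Matrix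

variable {ι : Type*} [Fintype ι]

/-- A sum of powers, one for each entry. Applying it makes nonzero nonnegative vectors strictly
positive without disturbing A. -/
lemma exists_commute_pos [DecidableEq ι] {A : Matrix ι ι ℝ} (hA : A.IsIrreducible) :
    ∃ B : Matrix ι ι ℝ, Commute B A ∧ ∀ i j, 0 < B i j := by
  choose p _ hp using (isIrreducible_iff_exists_pow_pos hA.nonneg).1 hA
  refine ⟨∑ i, ∑ j, A ^ p i j, ?_, fun i j => ?_⟩
  · exact Commute.sum_left _ _ _ fun i _ => Commute.sum_left _ _ _ fun j _ =>
      (Commute.refl A).pow_left _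
  · have hnn : ∀ a b, 0 ≤ (A ^ p a b) i j := fun a b => pow_apply_nonneg hA.nonneg _ _ _
    simp only [Matrix.sum_apply]
    exact Finset.sum_pos' (fun a _ => Finset.sum_nonneg fun b _ => hnn a b)
      ⟨i, Finset.mem_univ _, Finset.sum_pos' (fun b _ => hnn i b) ⟨j, Finset.mem_univ _, hp i j⟩⟩

lemma mulVec_pos_of_pos {B : Matrix ι ι ℝ} (hB : ∀ i j, 0 < B i j) {z : ι → ℝ}
    (hz : ∀ i, 0 ≤ z i) (hz0 : z ≠ 0) (i : ι) : 0 < (B *ᵥ z) i := by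
  obtain ⟨j, hj⟩ := Function.ne_iff.1 hz0
  exact Finset.sum_pos' (fun a _ => mul_nonneg (hB i a).le (hz a))
    ⟨j, Finset.mem_univ _, mul_pos (hB i j) (lt_of_le_of_ne (hz j) (Ne.symm hj))⟩

/-- The maximum in the Collatz–Wielandt variational problem is attained. -/
lemma exists_collatzWielandt_max [Nonempty ι] (A : Matrix ι ι ℝ) (hA : ∀ i j, 0 ≤ A i j) :
    ∃ lam : ℝ, 0 ≤ lam ∧ ∃ x ∈ stdSimplex ℝ ι, (∀ i, lam * x i ≤ (A *ᵥ x) i) ∧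
      ∀ t : ℝ, ∀ y ∈ stdSimplex ℝ ι, (∀ i, t * y i ≤ (A *ᵥ y) i) → t ≤ lam := by
  classical
  set T := ∑ i, ∑ j, A i j
  have hT : 0 ≤ T := Finset.sum_nonneg fun i _ => Finset.sum_nonneg fun j _ => hA i j
  have bound : ∀ t : ℝ, ∀ y ∈ stdSimplex ℝ ι, (∀ i, t * y i ≤ (A *ᵥ y) i) → t ≤ T := by
    intro t y hy h
    calc t = ∑ i, t * y i := by rw [← Finset.mul_sum, hy.2, mul_one]
      _ ≤ ∑ i, (A *ᵥ y) i := Finset.sum_le_sum fun i _ => h i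
      _ ≤ T := Finset.sum_le_sum fun i _ => Finset.sum_le_sum fun j _ =>
        mul_le_of_le_one_right (hA i j) (mem_Icc_of_mem_stdSimplex hy j).2
  -- Capping t at T loses no nonnegative t and makes the feasible set compact.
  let K : Set (ℝ × (ι → ℝ)) :=
    (Set.Icc 0 T ×ˢ stdSimplex ℝ ι) ∩ {p | ∀ i, p.1 * p.2 i ≤ (A *ᵥ p.2) i}
  have hK : IsCompact K := by
    refine (isCompact_Icc.prod (isCompact_stdSimplex ℝ ι)).inter_right ?_
    simp only [Set.ofPred_forall]
    refine isClosed_iInter fun i => isClosed_le (by fun_prop) ?_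
    simp only [mulVec, dotProduct]
    fun_prop
  obtain ⟨i₀⟩ := ‹Nonempty ι›
  have hne : K.Nonempty := by
    refine ⟨(0, Pi.single i₀ 1), ⟨⟨le_rfl, hT⟩, single_mem_stdSimplex ℝ i₀⟩, fun i => ?_⟩
    simp [hA]
  obtain ⟨⟨lam, x⟩, ⟨⟨hl, hx⟩, hlx⟩, hmax⟩ :=
    hK.exists_isMaxOn hne (f := Prod.fst) continuous_fst.continuousOn
  refine ⟨lam, hl.1, x, hx, hlx, fun t y hy h => ?_⟩
  rcases le_total t 0 with h0 | h0
  · exact h0.trans hl.1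
  · exact hmax (a := (t, y)) ⟨⟨⟨h0, bound t y hy h⟩, hy⟩, h⟩

/-- Perron–Frobenius: an irreducible matrix has a positive eigenvector. -/
theorem exists_pos_eigenvector [Nonempty ι] {A : Matrix ι ι ℝ} (hA : A.IsIrreducible) :
    ∃ lam : ℝ, 0 < lam ∧ ∃ v : ι → ℝ, (∀ i, 0 < v i) ∧ A *ᵥ v = lam • v := by
  classical
  obtain ⟨lam, hl, x, hx, hlx, hmax⟩ := exists_collatzWielandt_max A hA.nonneg
  obtain ⟨B, hBA, hB⟩ := exists_commute_pos hA
  have hx0 : x ≠ 0 := by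
    rintro rfl
    simpa using hx.2
  have hy : ∀ i, 0 < (B *ᵥ x) i := mulVec_pos_of_pos hB hx.1 hx0
  set y := B *ᵥ x with hydef
  have heq : A *ᵥ x = lam • x := by
    -- Otherwise B turns the slack of x into strict slack in every coordinate of y, and the least
    -- ratio (A y)ᵢ / yᵢ beats the maximal `lam`.
    by_contra hne
    have hz : ∀ i, 0 < (B *ᵥ (A *ᵥ x - lam • x)) i :=
      mulVec_pos_of_pos hB (fun i => by simpa using hlx i) (sub_ne_zero.2 hne)
    have hAy : B *ᵥ (A *ᵥ x - lam • x) = A *ᵥ y - lam • y := by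
      rw [mulVec_sub, mulVec_smul, mulVec_mulVec, hBA.eq, ← mulVec_mulVec]
    rw [hAy] at hz
    obtain ⟨i₁, -, hi₁⟩ := Finset.exists_min_image Finset.univ
      (fun i => (A *ᵥ y) i / y i) Finset.univ_nonempty
    have hS : 0 < ∑ i, y i := Finset.sum_pos (fun i _ => hy i) Finset.univ_nonempty
    have hle : (A *ᵥ y) i₁ / y i₁ ≤ lam := by
      refine hmax _ ((∑ i, y i)⁻¹ • y) ⟨fun i => ?_, ?_⟩ fun i => ?_
      · exact mul_nonneg (inv_nonneg.2 hS.le) (hy i).le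
      · simp only [Pi.smul_apply, smul_eq_mul, ← Finset.mul_sum]
        exact inv_mul_cancel₀ hS.ne'
      · rw [mulVec_smul]
        simp only [Pi.smul_apply, smul_eq_mul]
        rw [mul_left_comm]
        exact mul_le_mul_of_nonneg_left
          ((le_div_iff₀ (hy i)).1 (hi₁ i (Finset.mem_univ i))) (inv_nonneg.2 hS.le)
    have := hz i₁
    rw [div_le_iff₀ (hy i₁)] at hle
    simp only [Pi.sub_apply, Pi.smul_apply, smul_eq_mul] at this
    linarith
  have hAy : A *ᵥ y = lam • y := by
    rw [hydef, mulVec_mulVec, ← hBA.eq, ← mulVec_mulVec, heq, mulVec_smul]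
  refine ⟨lam, lt_of_le_of_ne hl ?_, y, hy, hAy⟩
  rintro rfl
  obtain ⟨i⟩ := ‹Nonempty ι›
  obtain ⟨p, hp, hpp⟩ := (isIrreducible_iff_exists_pow_pos hA.nonneg).1 hA i i
  have h0 : A ^ p *ᵥ y = 0 := by
    obtain ⟨q, rfl⟩ := Nat.exists_eq_add_of_lt hp
    rw [pow_succ, ← mulVec_mulVec, hAy, zero_smul, mulVec_zero]
  have h1 : 0 < (A ^ p *ᵥ y) i :=
    Finset.sum_pos' (fun j _ => mul_nonneg (pow_apply_nonneg hA.nonneg _ _ _) (hy j).le)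
      ⟨i, Finset.mem_univ _, mul_pos hpp (hy i)⟩
  rw [h0] at h1
  exact lt_irrefl _ h1

/-- The eigenvalue of a positive eigenvector of a nonnegative matrix is the largest one. -/
theorem isGreatest_of_pos_eigenvector [Nonempty ι] [DecidableEq ι] {A : Matrix ι ι ℝ}
    (hA : ∀ i j, 0 ≤ A i j)
    {lam : ℝ} (hl : 0 < lam) {v : ι → ℝ} (hv : ∀ i, 0 < v i) (hAv : A *ᵥ v = lam • v) :
    IsGreatest {μ : ℝ | 0 < μ ∧ Module.End.HasEigenvalue (Matrix.toLin' A) μ} lam := by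
  refine ⟨⟨hl, Module.End.hasEigenvalue_of_hasEigenvector (x := v) ⟨?_, ?_⟩⟩, ?_⟩
  · rw [Module.End.mem_eigenspace_iff, toLin'_apply, hAv]
  · rintro rfl
    exact lt_irrefl _ (hv (Classical.arbitrary ι))
  · rintro μ ⟨hμ, hev⟩
    obtain ⟨w, hw⟩ := hev.exists_hasEigenvector
    have hAw : A *ᵥ w = μ • w := by
      rw [← toLin'_apply]; exact hw.apply_eq_smul
    -- c is the least constant with |w| ≤ c v; equality at i allows the eigenvalues to be compared
    -- there.
    obtain ⟨i, -, hi⟩ := Finset.exists_max_image Finset.univ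
      (fun i => |w i| / v i) Finset.univ_nonempty
    set c := |w i| / v i with hc
    have hcw : ∀ j, |w j| ≤ c * v j := fun j =>
      (div_le_iff₀ (hv j)).1 (hi j (Finset.mem_univ j))
    have hci : |w i| = c * v i := (div_mul_cancel₀ _ (hv i).ne').symm
    have hcpos : 0 < c := by
      obtain ⟨j, hj⟩ := Function.ne_iff.1 hw.2
      by_contra! hneg
      have := hcw j
      have h2 : 0 < |w j| := abs_pos.2 hj
      nlinarith [hv j]
    have key : μ * (c * v i) ≤ lam * (c * v i) := by
      calc μ * (c * v i) = |(A *ᵥ w) i| := by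
            rw [hAw, ← hci]; simp [abs_mul, abs_of_pos hμ]
        _ ≤ ∑ j, |A i j * w j| := Finset.abs_sum_le_sum_abs _ _
        _ ≤ ∑ j, A i j * (c * v j) := Finset.sum_le_sum fun j _ => by
            rw [abs_mul, abs_of_nonneg (hA i j)]
            exact mul_le_mul_of_nonneg_left (hcw j) (hA i j)
        _ = c * (A *ᵥ v) i := by
            simp only [mulVec, dotProduct, Finset.mul_sum]
            exact Finset.sum_congr rfl fun j _ => by ring
        _ = lam * (c * v i) := by rw [hAv]; simp only [Pi.smul_apply, smul_eq_mul]; ring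
    exact le_of_mul_le_mul_right key (mul_pos hcpos (hv i))

end PerronFrobenius

end MaxPool

namespace MaxPool

/-! ### Growth rate of the number of walks -/

section WalkCount

open Matrix

variable {ι : Type*} [Fintype ι]

/-- The sum over all walks with `n + 1` vertices of the product of the weights of the arcs,
weighted by `v` at the last vertex. -/
def walkSum (A : Matrix ι ι ℝ) (n : ℕ) (v : ι → ℝ) : ℝ :=
  ∑ f : Fin (n + 1) → ι, (∏ i : Fin n, A (f i.castSucc) (f i.succ)) * v (f (Fin.last n))

lemma walkSum_zero (A : Matrix ι ι ℝ) (v : ι → ℝ) : walkSum A 0 v = ∑ i, v i := by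
  simp only [walkSum, Finset.univ_eq_empty, Finset.prod_empty, one_mul]
  exact Fintype.sum_equiv (Equiv.funUnique (Fin 1) ι) _ _ fun f => rfl

/-- Summing out the last vertex replaces the end weight v by A v, so an eigenvector as end weight
only contributes powers of λ. -/
lemma walkSum_succ (A : Matrix ι ι ℝ) (n : ℕ) (v : ι → ℝ) :
    walkSum A (n + 1) v = walkSum A n (A *ᵥ v) := by
  rw [walkSum, ← (Fin.snocEquiv fun _ : Fin (n + 2) => ι).sum_comp, Fintype.sum_prod_type_right]
  refine Finset.sum_congr rfl fun f _ => ?_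
  simp only [mulVec, dotProduct, Finset.mul_sum]
  refine Finset.sum_congr rfl fun x _ => ?_
  rw [Fin.prod_univ_castSucc]
  simp only [Fin.snocEquiv, Equiv.coe_fn_mk, Fin.snoc_castSucc, Fin.succ_last, Fin.snoc_last,
    ← Fin.castSucc_succ]
  rw [mul_assoc]

lemma walkSum_smul (A : Matrix ι ι ℝ) (n : ℕ) (c : ℝ) (v : ι → ℝ) :
    walkSum A n (c • v) = c * walkSum A n v := by
  simp only [walkSum, Finset.mul_sum, Pi.smul_apply, smul_eq_mul]
  exact Finset.sum_congr rfl fun f _ => by ring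

lemma walkSum_eigenvector {A : Matrix ι ι ℝ} {lam : ℝ} {v : ι → ℝ} (h : A *ᵥ v = lam • v)
    (n : ℕ) : walkSum A n v = lam ^ n * ∑ i, v i := by
  induction n with
  | zero => simp [walkSum_zero]
  | succ n ih => rw [walkSum_succ, h, walkSum_smul, ih, pow_succ]; ring

lemma walkSum_mono {A : Matrix ι ι ℝ} (hA : ∀ i j, 0 ≤ A i j) (n : ℕ) {v w : ι → ℝ}
    (h : ∀ i, v i ≤ w i) : walkSum A n v ≤ walkSum A n w :=
  Finset.sum_le_sum fun _ _ =>
    mul_le_mul_of_nonneg_left (h _) (Finset.prod_nonneg fun _ _ => hA _ _)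

lemma tendsto_log_of_geometric_bounds {a : ℕ → ℝ} {lam c C : ℝ} (hl : 0 < lam) (hc : 0 < c)
    (hC : 0 < C) (hlow : ∀ n, c * lam ^ n ≤ a n) (hup : ∀ n, a n ≤ C * lam ^ n) :
    Tendsto (fun n : ℕ => (1 / (n : ℝ)) * Real.log (a (n - 1))) atTop (𝓝 (Real.log lam)) := by
  have lim : ∀ d : ℝ, Tendsto (fun n : ℕ => (Real.log d - Real.log lam) / (n : ℝ) + Real.log lam)
      atTop (𝓝 (Real.log lam)) := fun d => by
    simpa using (tendsto_const_div_atTop_nhds_zero_nat (Real.log d - Real.log lam)).add_const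
      (Real.log lam)
  have expand : ∀ d : ℝ, 0 < d → ∀ n : ℕ, (1 / ((n + 1 : ℕ) : ℝ)) * Real.log (d * lam ^ n) =
      (Real.log d - Real.log lam) / ((n + 1 : ℕ) : ℝ) + Real.log lam := by
    intro d hd n
    rw [Real.log_mul hd.ne' (pow_pos hl n).ne', Real.log_pow]
    have : ((n + 1 : ℕ) : ℝ) ≠ 0 := by positivity
    field_simp
    push_cast
    ring
  refine tendsto_of_tendsto_of_tendsto_of_le_of_le' (lim c) (lim C) ?_ ?_
  all_goals
    filter_upwards [eventually_ge_atTop 1] with n hn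
    obtain ⟨m, rfl⟩ := Nat.exists_eq_add_of_le' hn
    have hpos : 0 < c * lam ^ m := mul_pos hc (pow_pos hl m)
    rw [Nat.add_sub_cancel]
  · rw [← expand c hc]
    exact mul_le_mul_of_nonneg_left (Real.log_le_log hpos (hlow m)) (by positivity)
  · rw [← expand C hC]
    exact mul_le_mul_of_nonneg_left (Real.log_le_log (hpos.trans_le (hlow m)) (hup m))
      (by positivity)

theorem tendsto_log_walkSum [Nonempty ι] {A : Matrix ι ι ℝ} (hA : ∀ i j, 0 ≤ A i j)
    {lam : ℝ} (hl : 0 < lam) {v : ι → ℝ} (hv : ∀ i, 0 < v i) (hAv : A *ᵥ v = lam • v) :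
    Tendsto (fun n : ℕ => (1 / (n : ℝ)) * Real.log (walkSum A (n - 1) 1))
      atTop (𝓝 (Real.log lam)) := by
  obtain ⟨i, -, hi⟩ := Finset.exists_min_image Finset.univ v Finset.univ_nonempty
  obtain ⟨j, -, hj⟩ := Finset.exists_max_image Finset.univ v Finset.univ_nonempty
  have hS : 0 < ∑ i, v i := Finset.sum_pos (fun i _ => hv i) Finset.univ_nonempty
  -- The constants come from (min v)·1 ≤ v ≤ (max v)·1.
  refine tendsto_log_of_geometric_bounds (a := fun n => walkSum A n 1) (c := (∑ i, v i) / v j) (C := (∑ i, v i) / v i) hl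
    (div_pos hS (hv j)) (div_pos hS (hv i)) (fun n => ?_) fun n => ?_
  · have := walkSum_mono hA n (v := v) (w := v j • 1)
      fun a => by simpa using hj a (Finset.mem_univ a)
    rw [walkSum_smul, walkSum_eigenvector hAv] at this
    rw [div_mul_eq_mul_div, div_le_iff₀ (hv j)]
    linarith
  · have := walkSum_mono hA n (w := v) (v := v i • 1)
      fun a => by simpa using hi a (Finset.mem_univ a)
    rw [walkSum_smul, walkSum_eigenvector hAv] at this
    rw [div_mul_eq_mul_div, le_div_iff₀ (hv i)]
    linarith

end WalkCount

end MaxPool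

namespace MaxPool

/-! ### Vertices of Minkowski sums of simplices -/

section MinkowskiSum

variable {N : ℕ}

lemma single_mem_simplex {S : Set (Fin N)} {x : Fin N} (hx : x ∈ S) :
    (Pi.single x 1 : Fin N → ℝ) ∈ simplex S :=
  subset_convexHull ℝ _ ⟨x, hx, rfl⟩

lemma mem_stdSimplex_of_mem_simplex {S : Set (Fin N)} {y : Fin N → ℝ} (hy : y ∈ simplex S) :
    y ∈ stdSimplex ℝ (Fin N) ∧ ∀ x ∉ S, y x = 0 := by
  have hconv : Convex ℝ {y : Fin N → ℝ | y ∈ stdSimplex ℝ (Fin N) ∧ ∀ x ∉ S, y x = 0} := by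
    rintro y ⟨hy, hy'⟩ z ⟨hz, hz'⟩ a b ha hb hab
    refine ⟨convex_stdSimplex ℝ (Fin N) hy hz ha hb hab, fun x hx => ?_⟩
    simp [hy' x hx, hz' x hx]
  refine convexHull_min ?_ hconv hy
  rintro _ ⟨p, hp, rfl⟩
  refine ⟨single_mem_stdSimplex ℝ p, fun x hx => ?_⟩
  exact Pi.single_eq_of_ne (by rintro rfl; exact hx hp) _

/-- A functional with a strict maximum over the vertices of a simplex attains its maximum over
the simplex only there. -/
lemma dotProduct_le_of_mem_simplex {S : Set (Fin N)} {c : Fin N → ℝ} {p : Fin N}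
    (hc : ∀ x ∈ S, x ≠ p → c x < c p) {y : Fin N → ℝ} (hy : y ∈ simplex S) :
    c ⬝ᵥ y ≤ c p ∧ (c ⬝ᵥ y = c p → y = Pi.single p 1) := by
  obtain ⟨⟨hy0, hy1⟩, hyS⟩ := mem_stdSimplex_of_mem_simplex hy
  -- As y has total mass 1, the gap is an average of the nonnegative gaps over S.
  have hdiff : c p - c ⬝ᵥ y = ∑ x, (c p - c x) * y x := by
    simp only [sub_mul, Finset.sum_sub_distrib, ← Finset.mul_sum, hy1, dotProduct, mul_one]
  have hterm : ∀ x, 0 ≤ (c p - c x) * y x := by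
    intro x
    by_cases hx : x ∈ S
    · rcases eq_or_ne x p with rfl | hxp
      · simp
      · exact mul_nonneg (sub_nonneg.2 (hc x hx hxp).le) (hy0 x)
    · simp [hyS x hx]
  refine ⟨sub_nonneg.1 (hdiff ▸ Finset.sum_nonneg fun x _ => hterm x), fun h => ?_⟩
  rw [h, sub_self, eq_comm, Finset.sum_eq_zero_iff_of_nonneg fun x _ => hterm x] at hdiff
  have hzero : ∀ x, x ≠ p → y x = 0 := by
    intro x hxp
    by_cases hx : x ∈ S
    · exact (mul_eq_zero.1 (hdiff x (Finset.mem_univ x))).resolve_left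
        (sub_pos.2 (hc x hx hxp)).ne'
    · exact hyS x hx
  have hyp : y p = 1 := by
    rw [← hy1, Finset.sum_eq_single p (fun x _ => hzero x) (by simp)]
  ext x
  rcases eq_or_ne x p with rfl | hxp
  · simp [hyp]
  · simp [hzero x hxp, hxp]

variable {ι : Type*} [Fintype ι]

lemma mem_sum_simplex {S : ι → Set (Fin N)} {y : Fin N → ℝ} :
    y ∈ ∑ i, simplex (S i) ↔ ∃ a : ι → Fin N → ℝ, (∀ i, a i ∈ simplex (S i)) ∧ ∑ i, a i = y := by
  simpa using Set.mem_finsetSum Finset.univ (fun i => simplex (S i)) y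

/-- Termwise upper bounds that add up to equality are all equalities. This uniqueness of the
decomposition serves both extremality and injectivity. -/
lemma eq_of_dotProduct_sum_eq {S : ι → Set (Fin N)} {f : ι → Fin N} {c : Fin N → ℝ}
    (hc : ∀ i, ∀ x ∈ S i, x ≠ f i → c x < c (f i)) {a : ι → Fin N → ℝ}
    (ha : ∀ i, a i ∈ simplex (S i)) (h : ∑ i, c (f i) ≤ c ⬝ᵥ ∑ i, a i) (i : ι) :
    a i = Pi.single (f i) 1 := by
  rw [dotProduct_sum] at h
  have hle : ∀ i ∈ Finset.univ, c ⬝ᵥ a i ≤ c (f i) := fun i _ =>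
    (dotProduct_le_of_mem_simplex (hc i) (ha i)).1
  have heq := (Finset.sum_eq_sum_iff_of_le hle).1 (le_antisymm (Finset.sum_le_sum hle) h)
  exact (dotProduct_le_of_mem_simplex (hc i) (ha i)).2 (heq i (Finset.mem_univ i))

lemma dotProduct_sum_single (c : Fin N → ℝ) (f : ι → Fin N) :
    c ⬝ᵥ ∑ i, (Pi.single (f i) 1 : Fin N → ℝ) = ∑ i, c (f i) := by
  simp [dotProduct_sum]

theorem sum_single_mem_extremePoints {S : ι → Set (Fin N)} {f : ι → Fin N} (hf : ∀ i, f i ∈ S i)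
    {c : Fin N → ℝ} (hc : ∀ i, ∀ x ∈ S i, x ≠ f i → c x < c (f i)) :
    ∑ i, (Pi.single (f i) 1 : Fin N → ℝ) ∈ (∑ i, simplex (S i)).extremePoints ℝ := by
  refine ⟨mem_sum_simplex.2 ⟨_, fun i => single_mem_simplex (hf i), rfl⟩, ?_⟩
  intro y hy z hz hmem
  obtain ⟨a, ha, rfl⟩ := mem_sum_simplex.1 hy
  obtain ⟨b, hb, rfl⟩ := mem_sum_simplex.1 hz
  obtain ⟨r, t, hr, ht, hrt, hv⟩ := hmem
  have hbound : c ⬝ᵥ ∑ i, b i ≤ ∑ i, c (f i) := by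
    rw [dotProduct_sum]
    exact Finset.sum_le_sum fun i _ => (dotProduct_le_of_mem_simplex (hc i) (hb i)).1
  have hval := congrArg (c ⬝ᵥ ·) hv
  simp only [dotProduct_add, dotProduct_smul, dotProduct_sum_single, smul_eq_mul] at hval
  refine Finset.sum_congr rfl fun i _ => eq_of_dotProduct_sum_eq hc ha ?_ i
  have ht' : t = 1 - r := by linarith
  subst ht'
  nlinarith

theorem exists_eq_sum_single_of_mem_extremePoints {S : ι → Set (Fin N)} {v : Fin N → ℝ}
    (hv : v ∈ (∑ i, simplex (S i)).extremePoints ℝ) :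
    ∃ f : ι → Fin N, (∀ i, f i ∈ S i) ∧ v = ∑ i, Pi.single (f i) 1 ∧
      ∀ i j, f i ∈ S j → f j ∈ S i → f i = f j := by
  classical
  obtain ⟨a, ha, rfl⟩ := mem_sum_simplex.1 hv.1
  have hupd : ∀ i b, b ∈ simplex (S i) →
      b + ∑ j ∈ Finset.univ.erase i, a j ∈ ∑ j, simplex (S j) := by
    intro i b hb
    refine mem_sum_simplex.2 ⟨Function.update a i b, fun j => ?_, ?_⟩
    · rcases eq_or_ne j i with rfl | hj
      · simpa
      · simpa [hj] using ha j
    · rw [← Finset.add_sum_erase _ _ (Finset.mem_univ i), Function.update_self]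
      congr 1
      exact Finset.sum_congr rfl fun j hj =>
        Function.update_of_ne (Finset.ne_of_mem_erase hj) _ _
  have hsplit : ∀ i, ∑ j, a j = a i + ∑ j ∈ Finset.univ.erase i, a j := fun i =>
    (Finset.add_sum_erase _ _ (Finset.mem_univ i)).symm
  have hext : ∀ i, a i ∈ (simplex (S i)).extremePoints ℝ := by
    refine fun i => ⟨ha i, fun y hy z hz hmem => ?_⟩
    have h := hv.2 (hupd i y hy) (hupd i z hz) ?_
    · rw [hsplit i] at h
      exact add_right_cancel h
    · obtain ⟨r, t, hr, ht, hrt, h⟩ := hmem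
      refine ⟨r, t, hr, ht, hrt, ?_⟩
      rw [hsplit i, ← h, smul_add, smul_add, add_add_add_comm, ← add_smul, hrt, one_smul]
  choose f hf hfa using fun i => extremePoints_convexHull_subset (hext i)
  simp only at hfa
  refine ⟨f, hf, Finset.sum_congr rfl fun i _ => (hfa i).symm, fun i j hij hji => ?_⟩
  -- Exchange: the point is the midpoint of the two sums in which one of e_(f i), e_(f j) is
  -- replaced by the other.
  have h := hv.2 (hupd i _ (single_mem_simplex hji)) (hupd j _ (single_mem_simplex hij)) ?_
  · rw [hsplit i] at h
    have h := add_right_cancel h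
    rw [← hfa i] at h
    by_contra hne
    have := congrFun h (f i)
    simp [hne] at this
  · refine ⟨1 / 2, 1 / 2, by norm_num, by norm_num, by norm_num, ?_⟩
    have h1 := hsplit i
    have h2 := hsplit j
    rw [← hfa i] at h1
    rw [← hfa j] at h2
    ext x
    have h1 := congrFun h1 x
    have h2 := congrFun h2 x
    simp only [Pi.add_apply, Pi.smul_apply, smul_eq_mul] at h1 h2 ⊢
    linarith

end MinkowskiSum

end MaxPool

namespace MaxPool

/-! ### Realizing consistent choices by weights -/

section Realizability

/-- A choice of one position in each window which is consistent on consecutive windows is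
realized by some weight function on the positions. -/
lemma exists_weight_of_consistent {k s m : ℕ} {g : ℕ → ℕ}
    (hg : ∀ i ≤ m, s * i ≤ g i ∧ g i < s * i + k)
    (hc : ∀ i < m, s * (i + 1) ≤ g i → g (i + 1) < s * i + k → g (i + 1) = g i) :
    ∃ c : ℕ → ℤ, ∀ j ≤ m, ∀ x, s * j ≤ x → x < s * j + k → x ≠ g j → c x < c (g j) := by
  induction m with
  | zero =>
    refine ⟨fun x => if x = g 0 then 1 else 0, fun j hj x _ _ hx => ?_⟩
    obtain rfl := Nat.le_zero.1 hj
    simp [hx]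
  | succ m ih =>
    obtain ⟨c, hcw⟩ := ih (fun i hi => hg i (by omega)) fun i hi => hc i (by omega)
    -- A descent g (j+1) < g j would put both positions in both windows, where consistency forces
    -- equality.
    have hmono : ∀ j ≤ m, g j ≤ g (j + 1) := by
      intro j hj
      have h1 := hg j (by omega)
      have h2 := hg (j + 1) (by omega)
      have h3 := hc j (by omega)
      by_contra! hlt
      have := h3 (by omega) (by omega)
      omega
    have hle : ∀ j ≤ m, g j ≤ g m := by
      intro j hj
      refine Nat.decreasingInduction' (P := fun j => g j ≤ g m) ?_ hj le_rfl
      exact fun j hj _ h => (hmono j hj.le).trans h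
    have hbound : ∀ n : ℕ, ∃ L H : ℤ, ∀ x ≤ n, L < c x ∧ c x < H := by
      intro n
      induction n with
      | zero =>
        refine ⟨c 0 - 1, c 0 + 1, fun x hx => ?_⟩
        obtain rfl := Nat.le_zero.1 hx
        omega
      | succ n ihn =>
        obtain ⟨L, H, h⟩ := ihn
        refine ⟨min L (c (n + 1) - 1), max H (c (n + 1) + 1), fun x hx => ?_⟩
        rcases Nat.lt_or_ge n x with h' | h'
        · obtain rfl : x = n + 1 := by omega
          omega
        · have := h x h'
          omega
    obtain ⟨L, H, hLH⟩ := hbound (g m)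
    have hLH0 := hLH 0 (Nat.zero_le _)
    have gm := hg m (by omega)
    have gm1 := hg (m + 1) le_rfl
    have hcm := hc m (by omega)
    have hmm := hmono m le_rfl
    have hss : s * (m + 1) = s * m + s := by ring
    -- Weights up to g m are kept, and L < c < H there. A new maximum beyond g m but inside window m
    -- must stay below c (g m): L works, since consistency then puts all of window m+1 beyond g m,
    -- where the other weights are L - 1. Outside window m it lies outside all earlier windows too,
    -- and may take H to beat everything.
    let T : ℤ := if g (m + 1) < s * m + k then L else H
    refine ⟨fun x => if x ≤ g m then c x else if x = g (m + 1) then T else L - 1,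
      fun j hj x hx1 hx2 hx => ?_⟩
    rcases Nat.lt_or_ge m j with hjm | hjm
    · obtain rfl : j = m + 1 := by omega
      have hcx := fun hxm => hcw m le_rfl x (by omega) hxm
      rcases Nat.lt_or_ge (g m) x with h | h
      · have hLm := hLH (g m) le_rfl
        rcases eq_or_lt_of_le hmm with he | he
        · simp only [← he, le_refl, if_true, if_neg (not_le.2 h)]
          rw [if_neg (by omega)]
          omega
        · simp only [if_neg (not_le.2 h), if_neg (not_le.2 he), if_neg hx, if_true, T]
          split_ifs <;> omega
      · have hLx := hLH x h
        rcases eq_or_lt_of_le hmm with he | he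
        · simp only [← he, le_refl, if_true, if_pos h]
          exact hcx (by omega) (by omega)
        · simp only [if_pos h, if_neg (not_le.2 he), if_true, T]
          split_ifs <;> omega
    · have hj' := hle j hjm
      have hLj := hLH (g j) hj'
      have hsj : s * j ≤ s * m := Nat.mul_le_mul_left s hjm
      simp only [if_pos hj', T]
      have hcx := hcw j hjm x hx1 hx2 hx
      split_ifs <;> omega

end Realizability

/-! ### Vertices of the polytope as walks -/

section Vertices

open Matrix

/-- The canonical basis index selected in the `i`-th window. -/
def position {k : ℕ} (s m : ℕ) (f : Fin (m + 1) → Fin k) (i : Fin (m + 1)) :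
    Fin (s * (m + 1 - 1) + k) :=
  ⟨s * i + f i, by
    have h1 : s * (i : ℕ) ≤ s * m := Nat.mul_le_mul_left s (Nat.lt_succ_iff.1 i.2)
    have h2 := (f i).2
    simp only [Nat.add_sub_cancel]
    omega⟩

/-- The walks with `m + 1` vertices in the digraph `D_{k,s}`. -/
def walks (k s m : ℕ) : Set (Fin (m + 1) → Fin k) :=
  {f | ∀ i : Fin m, (digraph k s).Adj (f i.castSucc) (f i.succ)}

lemma polytope_succ (m k s : ℕ) : polytope (m + 1) k s =
    ∑ i : Fin (m + 1), simplex (window (s * (m + 1 - 1) + k) k s i) :=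
  Finset.sum_range fun i => simplex (window (s * (m + 1 - 1) + k) k s i)

lemma position_mem_window {k : ℕ} (s m : ℕ) (f : Fin (m + 1) → Fin k) (i : Fin (m + 1)) :
    position s m f i ∈ window (s * (m + 1 - 1) + k) k s i :=
  ⟨Nat.le_add_right _ _, Nat.add_lt_add_left (f i).2 _⟩

lemma exists_weight_of_mem_walks {k s m : ℕ} {f : Fin (m + 1) → Fin k} (hf : f ∈ walks k s m) :
    ∃ c : Fin (s * (m + 1 - 1) + k) → ℝ,
      ∀ i : Fin (m + 1), ∀ x ∈ window (s * (m + 1 - 1) + k) k s i,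
      x ≠ position s m f i → c x < c (position s m f i) := by
  -- The default 0 lies beyond the last window and is never consulted.
  let g : ℕ → ℕ := fun i => if h : i < m + 1 then s * i + f ⟨i, h⟩ else 0
  have hgf : ∀ i (h : i < m + 1), g i = s * i + f ⟨i, h⟩ := fun i h => dif_pos h
  suffices h : ∃ c : ℕ → ℤ, ∀ j ≤ m, ∀ x, s * j ≤ x → x < s * j + k → x ≠ g j → c x < c (g j) by
    obtain ⟨c, hc⟩ := h
    refine ⟨fun x => (c x : ℝ), fun i x hx hne => Int.cast_lt.2 ?_⟩
    have := hc i (Nat.lt_succ_iff.1 i.2) x hx.1 hx.2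
    rw [hgf i i.2] at this
    exact this fun h => hne (Fin.ext h)
  apply exists_weight_of_consistent
  · intro i hi
    rw [hgf i (Nat.lt_succ_of_le hi)]
    exact ⟨Nat.le_add_right _ _, Nat.add_lt_add_left (f _).2 _⟩
  · intro i hi h1 h2
    have hadj := hf ⟨i, hi⟩
    simp only [digraph, Fin.castSucc_mk, Fin.succ_mk] at hadj
    rw [hgf i (by omega)] at h1 ⊢
    rw [hgf (i + 1) (by omega)] at h2 ⊢
    have hss : s * (i + 1) = s * i + s := by ring
    have hlt := (f ⟨i, by omega⟩).2
    by_contra hne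
    -- Offset s + a in window i is offset a in window i + 1, so two distinct shared choices form a
    -- missing arc.
    exact hadj ⟨f ⟨i, by omega⟩ - s, f ⟨i + 1, by omega⟩, by omega, by omega, by omega, by omega,
      rfl⟩

lemma extremePoints_polytope (m k s : ℕ) : (polytope (m + 1) k s).extremePoints ℝ =
    (fun f => ∑ i, (Pi.single (position s m f i) 1 : Fin (s * (m + 1 - 1) + k) → ℝ)) ''
      walks k s m := by
  rw [polytope_succ]
  ext v
  constructor
  · intro hv
    obtain ⟨p, hp, rfl, hpp⟩ := exists_eq_sum_single_of_mem_extremePoints hv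
    let f : Fin (m + 1) → Fin k := fun i => ⟨p i - s * i, by have := hp i; rw [window] at this; grind⟩
    have hf : ∀ i, (p i : ℕ) = s * i + f i := fun i => (Nat.add_sub_cancel' (hp i).1).symm
    have hpos : ∀ i, position s m f i = p i := fun i => Fin.ext (hf i).symm
    refine ⟨f, ?_, by simp only [hpos]⟩
    rintro i ⟨a, b, ha, hb, hab, hia, hib⟩
    have h1 := hf i.castSucc
    have h2 := hf i.succ
    have hss : s * ((i : ℕ) + 1) = s * i + s := by ring
    rw [hia, Fin.val_castSucc] at h1
    rw [hib, Fin.val_succ] at h2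
    have := congrArg Fin.val (hpp i.castSucc i.succ
      ⟨by rw [Fin.val_succ]; omega, by rw [Fin.val_succ]; omega⟩
      ⟨by rw [Fin.val_castSucc]; omega, by rw [Fin.val_castSucc]; omega⟩)
    omega
  · rintro ⟨f, hf, rfl⟩
    obtain ⟨c, hc⟩ := exists_weight_of_mem_walks hf
    exact sum_single_mem_extremePoints (position_mem_window s m f) hc

lemma injOn_sum_single_position (m k s : ℕ) : Set.InjOn
    (fun f => ∑ i, (Pi.single (position s m f i) 1 : Fin (s * (m + 1 - 1) + k) → ℝ))
    (walks k s m) := by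
  intro f hf f' _ h
  obtain ⟨c, hc⟩ := exists_weight_of_mem_walks hf
  simp only at h
  ext i
  have hi := eq_of_dotProduct_sum_eq hc (a := fun i => Pi.single (position s m f' i) 1)
    (fun i => single_mem_simplex (position_mem_window s m f' i))
    (by rw [← h, dotProduct_sum_single]) i
  have hp : position s m f' i = position s m f i := by
    by_contra hne
    have := congrFun hi (position s m f' i)
    simp [hne] at this
  exact (Nat.add_left_cancel (congrArg Fin.val hp)).symm

theorem numVertices_succ (m k s : ℕ) :
    (numVertices (m + 1) k s : ℝ) = walkSum (adjMatrix k s) m 1 := by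
  classical
  rw [numVertices, extremePoints_polytope, (injOn_sum_single_position m k s).ncard_image,
    Set.ncard_eq_toFinset_card', Finset.cast_card, walkSum]
  rw [show (walks k s m).toFinset = Finset.univ.filter (· ∈ walks k s m) by ext; simp,
    Finset.sum_filter]
  refine Finset.sum_congr rfl fun f _ => ?_
  simp only [adjMatrix, of_apply, Pi.one_apply, mul_one, Finset.prod_boole, Finset.mem_univ,
    true_imp_iff]
  exact if_congr Iff.rfl rfl rfl

end Vertices

/-! ### Strong connectivity of the digraph -/

section Irreducible

open Matrix

lemma adjMatrix_nonneg (k s : ℕ) (i j : Fin k) : 0 ≤ adjMatrix k s i j := by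
  classical
  rw [adjMatrix, of_apply]
  split_ifs <;> norm_num

lemma adjMatrix_pos {k s : ℕ} {i j : Fin k} (h : (digraph k s).Adj i j) :
    0 < adjMatrix k s i j := by
  classical
  rw [adjMatrix, of_apply, if_pos h]
  exact one_pos

/-- The arcs i → i - s are never removed (case a = b), so every vertex descends below s, from where
all arcs are present. -/
theorem adjMatrix_isIrreducible (k s : ℕ) (hs : 0 < s) : (adjMatrix k s).IsIrreducible := by
  rw [isIrreducible_iff_exists_pow_pos (adjMatrix_nonneg k s)]
  intro i j
  induction hn : (i : ℕ) using Nat.strong_induction_on generalizing i with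
  | _ n ih =>
    by_cases hi : (i : ℕ) < s
    · refine ⟨1, one_pos, ?_⟩
      rw [pow_one]
      exact adjMatrix_pos fun ⟨a, b, _, _, _, hia, _⟩ => by omega
    · let i' : Fin k := ⟨i - s, by omega⟩
      obtain ⟨p, _, hp⟩ := ih (i - s) (by omega) i' rfl
      refine ⟨p + 1, p.succ_pos, ?_⟩
      rw [pow_succ', mul_apply]
      have harc : 0 < adjMatrix k s i i' :=
        adjMatrix_pos fun ⟨a, b, _, _, hab, hia, hib⟩ => by
          have : (i : ℕ) - s = b := hib
          omega
      exact Finset.sum_pos' (fun l _ => mul_nonneg (adjMatrix_nonneg k s i l)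
        (pow_apply_nonneg (adjMatrix_nonneg k s) p l j)) ⟨i', Finset.mem_univ _, mul_pos harc hp⟩

end Irreducible

end MaxPool

theorem corollary4p12 (k s : ℕ) (hk : 0 < k) (hs : 0 < s) :
    (MaxPool.adjMatrix k s).IsIrreducible ∧
    ∃ lam : ℝ,
      IsGreatest {μ : ℝ | 0 < μ ∧
        Module.End.HasEigenvalue (Matrix.toLin' (MaxPool.adjMatrix k s)) μ} lam ∧
      Tendsto (fun n : ℕ => (1 / (n : ℝ)) * Real.log (MaxPool.numVertices n k s : ℝ))
        atTop (𝓝 (Real.log lam)) := by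
  have hirr := MaxPool.adjMatrix_isIrreducible k s hs
  have : Nonempty (Fin k) := ⟨⟨0, hk⟩⟩
  obtain ⟨lam, hl, v, hv, hAv⟩ := MaxPool.exists_pos_eigenvector hirr
  refine ⟨hirr, lam, MaxPool.isGreatest_of_pos_eigenvector hirr.nonneg hl hv hAv, ?_⟩
  refine (MaxPool.tendsto_log_walkSum hirr.nonneg hl hv hAv).congr' ?_
  -- n = 0 is discarded: the walk count uses n - 1 arcs.
  filter_upwards [eventually_ge_atTop 1] with n hn
  obtain ⟨m, rfl⟩ := Nat.exists_eq_add_of_le' hn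
  rw [MaxPool.numVertices_succ, Nat.add_sub_cancel]
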